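/- Let $V$ be Thompson's group $V$, that is, the group of all bijections $f$ of the set $\{0,1\}^{\mathbb N}$ of infinite binary words for which there is an $N\ge 0$ such that for every finite binary word $w$ of length $N$ there is a finite binary word $v$ with $f(wx)=vx$ for all infinite words $x$. Let $S=P_1*P_2$ be the free product of two copies $P_1,P_2$ of $V$. For $u\in P_1$ let $\phi_u\in\mathrm{Aut}(S)$ be the partial conjugation by $u$, i.e. the automorphism with $\phi_u(p)=p$ for $p\in P_1$ and $\phi_u(p)=upu^{-1}$ for $p\in P_2$. For each prime $p$ fix an element $u_p\in P_1$ of order $p$. For a finite, strictly increasing sequence of primes $(s_1,\dots,s_n)$ define the automorphism $\phi_{(s_1,\dots,s_n)}$ of $S^n=S\times\dots\times S$ by $$\phi_{(s_1,\dots,s_n)}(x_1,\dots,x_n)=(\phi_{u_{s_1}}(x_1),\dots,\phi_{u_{s_n}}(x_n)),$$ and let $G_{(s_1,\dots,s_n)}=S^n\rtimes_{\phi_{(s_1,\dots,s_n)}}\mathbb Z$ be the semidirect product in which the generator $1\in\mathbb Z$ acts on $S^n$ by $\phi_{(s_1,\dots,s_n)}$. Let $(s_1,\dots,s_n)$ and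 $(t_1,\dots,t_n)$ be strictly increasing sequences of prime numbers of the same length $n$. Then the groups $G_{(s_1,\dots,s_n)}$ and $G_{(t_1,\dots,t_n)}$ are isomorphic if and only if $\{s_1,\dots,s_n\}=\{t_1,\dots,t_n\}$. -/

import Mathlib

open scoped Monoid.Coprod

/-- A permutation `f` of the Cantor set of infinite binary words is a finite prefix replacement:
for some length `N`, every word `w` of length `N` has a finite word `v` such that
`f` sends `w x` to `v x` for all infinite words `x`. -/
def IsPrefixReplacement (f : Equiv.Perm (Stream' Bool)) : Prop :=
  ∃ N : ℕ, ∀ w : List Bool, w.length = N →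
    ∃ v : List Bool, ∀ x : Stream' Bool, f (w ++ₛ x) = v ++ₛ x

theorem IsPrefixReplacement.one : IsPrefixReplacement 1 :=
  ⟨0, fun w _ => ⟨w, fun _ => rfl⟩⟩

theorem IsPrefixReplacement.mul {f g : Equiv.Perm (Stream' Bool)}
    (hf : IsPrefixReplacement f) (hg : IsPrefixReplacement g) : IsPrefixReplacement (f * g) := by
  obtain ⟨N, hN⟩ := hf
  obtain ⟨M, hM⟩ := hg
  refine ⟨M + N, fun w hw => ?_⟩
  obtain ⟨v, hv⟩ := hM (w.take M) (by simp [hw])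
  obtain ⟨c, hc⟩ := hN ((v ++ w.drop M).take N) (by simp [hw])
  refine ⟨c ++ (v ++ w.drop M).drop N, fun x => ?_⟩
  have h1 : g (w ++ₛ x) = (v ++ w.drop M) ++ₛ x := by
    conv_lhs => rw [← List.take_append_drop M w]
    rw [Stream'.append_append_stream, hv, ← Stream'.append_append_stream]
  rw [Equiv.Perm.mul_apply, h1]
  conv_lhs => rw [← List.take_append_drop N (v ++ w.drop M)]
  rw [Stream'.append_append_stream, hc, ← Stream'.append_append_stream]

theorem IsPrefixReplacement.inv {f : Equiv.Perm (Stream' Bool)}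
    (hf : IsPrefixReplacement f) : IsPrefixReplacement f⁻¹ := by
  obtain ⟨N, hN⟩ := hf
  choose! F hF using hN
  -- a common bound for the lengths of the finitely many image prefixes
  obtain ⟨M, hM⟩ : ∃ M, ∀ w : List Bool, w.length = N → (F w).length ≤ M := by
    obtain ⟨M, hM⟩ := ((List.finite_length_eq Bool N).image fun w => (F w).length).bddAbove
    exact ⟨M, fun w hw => hM ⟨w, hw, rfl⟩⟩
  refine ⟨M, fun w hw => ?_⟩
  let y := f⁻¹ (w ++ₛ Stream'.const false)
  have hlen : (y.take N).length = N := by simp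
  have hy : F (y.take N) ++ₛ y.drop N = w ++ₛ Stream'.const false := by
    rw [← hF _ hlen, Stream'.append_take_drop]
    exact f.apply_symm_apply _
  have htake : ∀ (l : List Bool) (z : Stream' Bool) (k : ℕ),
      Stream'.take (l.length + k) (l ++ₛ z) = l ++ Stream'.take k z := by
    intro l z k
    induction l with
    | nil => simp
    | cons a l ih =>
      rw [Stream'.cons_append_stream, List.length_cons, Nat.add_right_comm, Stream'.take_succ_cons,
        ih, List.cons_append]
  have hp : F (y.take N) ++ (y.drop N).take (M - (F (y.take N)).length) = w := by
    have h1 := htake w (Stream'.const false) 0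
    rw [← htake, hy, Nat.add_sub_cancel' (hM _ hlen), ← hw]
    simpa using h1
  refine ⟨y.take N ++ (y.drop N).take (M - (F (y.take N)).length), fun x => ?_⟩
  rw [Equiv.Perm.inv_eq_iff_eq, Stream'.append_append_stream, hF _ hlen,
    ← Stream'.append_append_stream, hp]

/-- Thompson's group `V`, in its action on the Cantor set. -/
def ThompsonV : Subgroup (Equiv.Perm (Stream' Bool)) where
  carrier := {f | IsPrefixReplacement f}
  one_mem' := IsPrefixReplacement.one
  mul_mem' := IsPrefixReplacement.mul
  inv_mem' := IsPrefixReplacement.inv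

/-- The endomorphism of the free product `G ∗ H` that is the identity on `G` and
conjugation `p ↦ u p u⁻¹` by `u ∈ G` on `H`. -/
def partialConjHom {G H : Type*} [Group G] [Group H] (u : G) : (G ∗ H) →* (G ∗ H) :=
  Monoid.Coprod.lift Monoid.Coprod.inl
    ((MulAut.conj (Monoid.Coprod.inl u : G ∗ H)).toMonoidHom.comp Monoid.Coprod.inr)

theorem partialConjHom_comp_inv {G H : Type*} [Group G] [Group H] (u : G) :
    (partialConjHom u⁻¹).comp (partialConjHom u) = MonoidHom.id (G ∗ H) := by
  apply Monoid.Coprod.hom_ext <;> ext x <;> simp [partialConjHom, mul_assoc]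

/-- The partial conjugation of `G ∗ H` by `u ∈ G`, as an automorphism. -/
def partialConj {G H : Type*} [Group G] [Group H] (u : G) : MulAut (G ∗ H) :=
  MonoidHom.toMulEquiv (partialConjHom u) (partialConjHom u⁻¹)
    (partialConjHom_comp_inv u) (by simpa using partialConjHom_comp_inv (H := H) u⁻¹)

/-- The free product `S = V ∗ V`. -/
abbrev ThompsonS : Type := ThompsonV ∗ ThompsonV

/-- The automorphism `(x₁, …, xₙ) ↦ (φ_{v₁} x₁, …, φ_{vₙ} xₙ)` of `Sⁿ`,
where `φ_{vᵢ}` is the partial conjugation by `vᵢ`. -/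
def prodPartialConj {n : ℕ} (v : Fin n → ThompsonV) : MulAut (Fin n → ThompsonS) :=
  MulEquiv.piCongrRight fun i => partialConj (v i)

/-- The semidirect product `(S × ⋯ × S) ⋊ ℤ` in which the generator `1` of `ℤ` acts
by `prodPartialConj v`. -/
abbrev ThompsonSemidirect {n : ℕ} (v : Fin n → ThompsonV) : Type :=
  (Fin n → ThompsonS) ⋊[zpowersHom (MulAut (Fin n → ThompsonS)) (prodPartialConj v)]
    Multiplicative ℤ

/-! The isomorphism type remembers the order of the tuple $v=(u_{s_1},\dots,u_{s_n})$, whose prime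
divisors are exactly the $s_i$. Since $V$ is centreless, a central element $(x,k)$ of
$S^n\rtimes\mathbb Z$ has $v^k=1$, and each $x_i$ dies in both projections $S\to V$, so $x$ dies in
every homomorphism to $\mathbb Z$. Such homomorphisms therefore send the centre into multiples of
the order of $v$ (`orderOf_dvd_of_mem_center`). The projection to $\mathbb Z$ attains the order
itself, because $(1,k)$ is central when $v^k=1$. -/

/-- A permutation of the Cantor set which does not change the letters from position `N` on, and
whose first `N` output letters depend on the first `N` input letters only, is a finite prefix
replacement. -/
theorem isPrefixReplacement_of_forall_get {f : Equiv.Perm (Stream' Bool)} (N : ℕ)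
    (hlow : ∀ x y : Stream' Bool, (∀ j < N, x.get j = y.get j) → ∀ j < N, (f x).get j = (f y).get j)
    (hhigh : ∀ x : Stream' Bool, ∀ j, N ≤ j → (f x).get j = x.get j) :
    IsPrefixReplacement f := by
  refine ⟨N, fun w hw => ⟨(f (w ++ₛ Stream'.const false)).take N, fun x => ?_⟩⟩
  conv_lhs => rw [← Stream'.append_take_drop N (f (w ++ₛ x))]
  congr 1
  · refine List.ext_getElem (by simp) fun j hj _ => ?_
    rw [Stream'.length_take] at hj
    rw [Stream'.take_get, Stream'.take_get]
    refine hlow _ _ (fun i hi => ?_) j hj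
    rw [Stream'.get_append_left _ _ _ (by omega), Stream'.get_append_left _ _ _ (by omega)]
  · ext i
    rw [Stream'.get_drop, hhigh _ _ (Nat.le_add_right N i), ← hw, Stream'.get_append_right]

/-- The map flipping the letter at position `k + 1` of the words whose letter at position `k`
is `b`. -/
def flipSucc (k : ℕ) (b : Bool) (z : Stream' Bool) : Stream' Bool :=
  fun j => if j = k + 1 ∧ z k = b then !(z j) else z j

theorem flipSucc_involutive (k : ℕ) (b : Bool) : Function.Involutive (flipSucc k b) := by
  intro z
  funext j
  have hk : flipSucc k b z k = z k := by simp [flipSucc]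
  by_cases h : j = k + 1 ∧ z k = b
  · simp only [flipSucc] at hk ⊢
    simp [h]
  · simp only [flipSucc] at hk ⊢
    simp [h]

theorem isPrefixReplacement_flipSucc (k : ℕ) (b : Bool) :
    IsPrefixReplacement (flipSucc_involutive k b).toPerm := by
  refine isPrefixReplacement_of_forall_get (k + 2) (fun x y h j hj => ?_) fun x j hj => ?_
  · have h1 : x k = y k := h k (by omega)
    have h2 : x j = y j := h j hj
    change flipSucc k b x j = flipSucc k b y j
    simp [flipSucc, h1, h2]
  · change flipSucc k b x j = x j
    have : j ≠ k + 1 := by omega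
    simp [flipSucc, this]

/-- Thompson's group `V` contains an element that moves a given point and fixes another one. -/
theorem ThompsonV.exists_apply_ne_of_ne {x y : Stream' Bool} (h : x ≠ y) :
    ∃ g : ThompsonV, g.1 x ≠ x ∧ g.1 y = y := by
  obtain ⟨k, hk⟩ := Function.ne_iff.1 h
  -- At a position `k` where `x` and `y` differ, the letter `x k` is a test passed by `x` and failed
  -- by `y`.
  refine ⟨⟨_, isPrefixReplacement_flipSucc k (x k)⟩, fun hx => ?_, ?_⟩
  · have := congrFun hx (k + 1)
    simp [flipSucc] at this
  · funext j
    simp [flipSucc, hk.symm]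

/-- If `f` moves `x`, take `g` moving `x` and fixing `f x`: commuting gives `f (g x) = f x`, against
injectivity. -/
theorem ThompsonV.eq_one_of_forall_commute {f : ThompsonV} (hf : ∀ g, f * g = g * f) : f = 1 := by
  by_contra h
  obtain ⟨x, hx⟩ : ∃ x, f.1 x ≠ x := by
    by_contra! hx
    exact h (Subtype.ext (Equiv.ext hx))
  obtain ⟨g, hg, hg'⟩ := ThompsonV.exists_apply_ne_of_ne hx.symm
  refine hg (f.1.injective ?_)
  have := congrArg (fun a : ThompsonV => a.1 x) (hf g)
  simpa [hg'] using this

section PartialConj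

variable {G H : Type*} [Group G] [Group H]

@[simp]
theorem partialConj_inl (u g : G) :
    partialConj (H := H) u (Monoid.Coprod.inl g) = Monoid.Coprod.inl g := by
  simp [partialConj, partialConjHom]

@[simp]
theorem partialConj_inr (u : G) (h : H) :
    partialConj u (Monoid.Coprod.inr h : G ∗ H) =
      Monoid.Coprod.inl u * Monoid.Coprod.inr h * (Monoid.Coprod.inl u)⁻¹ := by
  simp [partialConj, partialConjHom]

/-- Partial conjugation by inverses, as a homomorphism from `G` to the automorphisms of `G ∗ H`. -/
def partialConjMonoidHom (G H : Type*) [Group G] [Group H] : G →* MulAut (G ∗ H) :=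
  -- Since $\phi_u$ fixes $v$, $\phi_u\phi_v=\phi_{vu}$; the inverse turns this anti-homomorphism
  -- into a homomorphism.
  MonoidHom.mk' (fun u => partialConj u⁻¹) fun u v => by
    apply MulEquiv.toMonoidHom_injective
    apply Monoid.Coprod.hom_ext <;> ext x <;> simp [mul_assoc]

theorem partialConj_one : partialConj (1 : G) = (1 : MulAut (G ∗ H)) := by
  simpa [partialConjMonoidHom] using (partialConjMonoidHom G H).map_one

end PartialConj

/-- If an inner automorphism of `G ∗ G` inverts the partial conjugation by `u`, where `G` is
centreless, then `u = 1` and the conjugating element projects to `1` in both factors. -/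
theorem eq_one_of_conj_partialConj {G : Type*} [Group G]
    (hG : ∀ f : G, (∀ g, f * g = g * f) → f = 1) {u : G} {x : G ∗ G}
    (hx : ∀ y, x * partialConj u y = y * x) :
    u = 1 ∧ Monoid.Coprod.fst x = 1 ∧ Monoid.Coprod.snd x = 1 := by
  -- Folding both factors onto `G` sends `x` to a central element, hence to 1; the second factor
  -- then makes `u` central.
  have hfold : Monoid.Coprod.lift (.id G) (.id G) x = 1 := hG _ fun g => by
    simpa using congrArg (Monoid.Coprod.lift (.id G) (.id G)) (hx (Monoid.Coprod.inl g))
  refine ⟨hG _ fun g => ?_, hG _ fun g => ?_, hG _ fun g => ?_⟩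
  · have := congrArg (Monoid.Coprod.lift (.id G) (.id G)) (hx (Monoid.Coprod.inr g))
    simpa [hfold, mul_inv_eq_iff_eq_mul] using this
  · simpa using congrArg Monoid.Coprod.fst (hx (Monoid.Coprod.inl g))
  · simpa using congrArg Monoid.Coprod.snd (hx (Monoid.Coprod.inr g))

/-- A homomorphism from a free product to a commutative group factors through the product. -/
theorem Monoid.Coprod.map_eq_one_of_fst_snd {G H A : Type*} [Group G] [Group H] [CommGroup A]
    (f : G ∗ H →* A) {x : G ∗ H} (h₁ : fst x = 1) (h₂ : snd x = 1) : f x = 1 := by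
  have : f = ((f.comp inl).comp fst) * ((f.comp inr).comp snd) := by
    apply Monoid.Coprod.hom_ext <;> ext x <;> simp
  rw [this]
  simp [h₁, h₂]

theorem MonoidHom.map_eq_one_of_forall_mulSingle {ι M : Type*} {N : ι → Type*} [Fintype ι]
    [DecidableEq ι] [∀ i, Monoid (N i)] [Monoid M] (f : (∀ i, N i) →* M) {x : ∀ i, N i}
    (h : ∀ i, f (Pi.mulSingle i (x i)) = 1) : f x = 1 := by
  refine (congrArg f (Finset.noncommProd_mulSingle x).symm).trans
    ((Finset.map_noncommProd _ _ _ f).trans ?_)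
  exact (Finset.noncommProd_eq_pow_card _ _ _ 1 fun i _ => h i).trans (one_pow _)

/-! ### The centre of the semidirect product -/

section Semidirect

variable {n : ℕ} (v : Fin n → ThompsonV)

theorem zpowersHom_prodPartialConj_apply (k : Multiplicative ℤ) (y : Fin n → ThompsonS)
    (i : Fin n) :
    zpowersHom (MulAut (Fin n → ThompsonS)) (prodPartialConj v) k y i =
      partialConj (v i ^ k.toAdd) (y i) := by
  let F : (Fin n → ThompsonV) →* MulAut (Fin n → ThompsonS) :=
    MonoidHom.mk' (fun a => prodPartialConj a⁻¹) fun a b => by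
      ext y i
      exact DFunLike.congr_fun ((partialConjMonoidHom ThompsonV ThompsonV).map_mul (a i) (b i)) (y i)
  have : prodPartialConj v ^ k.toAdd = prodPartialConj (v ^ k.toAdd) := by
    simpa [F] using (map_zpow F v⁻¹ k.toAdd).symm
  rw [zpowersHom_apply, this]
  rfl

theorem inr_mem_center_of_zpow_eq_one {k : ℤ} (hk : v ^ k = 1) :
    (SemidirectProduct.inr (Multiplicative.ofAdd k) : ThompsonSemidirect v) ∈
      Subgroup.center (ThompsonSemidirect v) := by
  have h1 : zpowersHom (MulAut (Fin n → ThompsonS)) (prodPartialConj v)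
      (Multiplicative.ofAdd k) = 1 := by
    ext y i
    rw [zpowersHom_prodPartialConj_apply, toAdd_ofAdd, ← Pi.pow_apply, hk, Pi.one_apply,
      partialConj_one]
    rfl
  rw [Subgroup.mem_center_iff]
  intro g
  ext
  · simp [h1]
  · simp [mul_comm]

/-- A homomorphism from `ThompsonSemidirect v` to `ℤ` maps the centre into the multiples of the
order of `v`. -/
theorem orderOf_dvd_of_mem_center {z : ThompsonSemidirect v}
    (hz : z ∈ Subgroup.center (ThompsonSemidirect v))
    (f : ThompsonSemidirect v →* Multiplicative ℤ) : (orderOf v : ℤ) ∣ (f z).toAdd := by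
  have key : ∀ i, v i ^ z.right.toAdd = 1 ∧ Monoid.Coprod.fst (z.left i) = 1 ∧
      Monoid.Coprod.snd (z.left i) = 1 := fun i => by
    refine eq_one_of_conj_partialConj (fun _ => ThompsonV.eq_one_of_forall_commute) fun y => ?_
    -- Commuting with a constant tuple in $S^n$ gives the hypothesis on partial conjugations in each
    -- coordinate.
    have h := congrFun (congrArg SemidirectProduct.left
      (Subgroup.mem_center_iff.1 hz (SemidirectProduct.inl fun _ => y))) i
    simp only [SemidirectProduct.mul_left, SemidirectProduct.left_inl, SemidirectProduct.right_inl,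
      map_one, MulAut.one_apply, Pi.mul_apply, zpowersHom_prodPartialConj_apply] at h
    exact h.symm
  have hleft : f (SemidirectProduct.inl z.left) = 1 :=
    (f.comp SemidirectProduct.inl).map_eq_one_of_forall_mulSingle fun i =>
      Monoid.Coprod.map_eq_one_of_fst_snd
        ((f.comp SemidirectProduct.inl).comp (MonoidHom.mulSingle (fun _ => ThompsonS) i))
        (key i).2.1 (key i).2.2
  have hdvd : (orderOf v : ℤ) ∣ z.right.toAdd :=
    orderOf_dvd_iff_zpow_eq_one.2 (funext fun i => (key i).1)
  have hright : f (SemidirectProduct.inr z.right) =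
      f (SemidirectProduct.inr (Multiplicative.ofAdd 1)) ^ z.right.toAdd := by
    rw [← map_zpow, ← map_zpow, ← ofAdd_zsmul]
    simp
  rw [← SemidirectProduct.inl_left_mul_inr_right z, map_mul, hleft, one_mul, hright, toAdd_zpow,
    smul_eq_mul]
  exact hdvd.mul_right _

/-- Pull the central element $(1,k)$, with $k$ the order of `w`, back along `e`; the projection to
$\mathbb Z$ composed with `e` takes the value $k$ there. -/
theorem orderOf_dvd_of_mulEquiv {v w : Fin n → ThompsonV}
    (e : ThompsonSemidirect v ≃* ThompsonSemidirect w) : orderOf v ∣ orderOf w := by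
  have hc := inr_mem_center_of_zpow_eq_one w (k := orderOf w) (by simp [pow_orderOf_eq_one])
  have h := orderOf_dvd_of_mem_center v (z := e.symm (SemidirectProduct.inr
    (Multiplicative.ofAdd (orderOf w : ℤ)))) (Subgroup.mem_center_iff.2 fun g => ?_)
    (SemidirectProduct.rightHom.comp e.toMonoidHom)
  · simpa [Int.natCast_dvd_natCast] using h
  · apply e.injective
    simpa using Subgroup.mem_center_iff.1 hc (e g)

end Semidirect

/-- A prime divides the order of a tuple of elements of prime orders `s i` if and only if it is
one of the `s i`. -/
theorem prime_dvd_orderOf_pi_iff {ι G : Type*} [Fintype ι] [Group G] {v : ι → G} {s : ι → ℕ}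
    (hs : ∀ i, (s i).Prime) (hv : ∀ i, orderOf (v i) = s i) {p : ℕ} (hp : p.Prime) :
    p ∣ orderOf v ↔ p ∈ Set.range s := by
  constructor
  · intro h
    have h1 : v ^ ∏ i, s i = 1 := funext fun i => by
      rw [Pi.pow_apply, Pi.one_apply, ← orderOf_dvd_iff_pow_eq_one, hv]
      exact Finset.dvd_prod_of_mem s (Finset.mem_univ i)
    obtain ⟨i, -, hi⟩ :=
      (hp.prime.dvd_finsetProd_iff s).1 (h.trans (orderOf_dvd_of_pow_eq_one h1))
    exact ⟨i, ((Nat.prime_dvd_prime_iff_eq hp (hs i)).1 hi).symm⟩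
  · rintro ⟨i, rfl⟩
    rw [← hv i]
    exact orderOf_map_dvd (Pi.evalMonoidHom (fun _ => G) i) v

theorem mainTheorem4
    (u : ℕ → ThompsonV) (hu : ∀ p : ℕ, p.Prime → orderOf (u p) = p)
    (n : ℕ) (s t : Fin n → ℕ)
    (hs : ∀ i, (s i).Prime) (ht : ∀ i, (t i).Prime)
    (hs_mono : StrictMono s) (ht_mono : StrictMono t) :
    Nonempty (ThompsonSemidirect (fun i => u (s i)) ≃* ThompsonSemidirect (fun i => u (t i))) ↔
      Set.range s = Set.range t := by
  constructor
  · rintro ⟨e⟩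
    have horder := Nat.dvd_antisymm (orderOf_dvd_of_mulEquiv e) (orderOf_dvd_of_mulEquiv e.symm)
    have hmem (p : ℕ) (hp : p.Prime) : p ∈ Set.range s ↔ p ∈ Set.range t := by
      rw [← prime_dvd_orderOf_pi_iff hs (fun i => hu _ (hs i)) hp, horder,
        prime_dvd_orderOf_pi_iff ht (fun i => hu _ (ht i)) hp]
    ext p
    constructor
    · rintro ⟨i, rfl⟩
      exact (hmem _ (hs i)).1 ⟨i, rfl⟩
    · rintro ⟨i, rfl⟩
      exact (hmem _ (ht i)).2 ⟨i, rfl⟩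
  · intro h
    obtain rfl := (hs_mono.range_inj ht_mono).1 h
    exact ⟨MulEquiv.refl _⟩
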